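/- For a regular cardinal $\theta$, let $H_\theta$ be the $\{\in\}$-structure of all sets that hereditarily have size less than $\theta$; an expansion $\langle H_\theta,\ldots\rangle$ is an expansion of $H_\theta$ to an $\mathcal L$-structure for some countable first-order language $\mathcal L$. Call a finite set $\Sigma$ a \emph{submodel chain} in $\langle H_\theta,\ldots\rangle$ if (i) $|N|\subseteq N\prec\langle H_\theta,\ldots\rangle$ for all $N\in\Sigma$ (cardinals being von Neumann ordinals), (ii) $\Sigma$ is an $\in$-chain, i.e. of any two distinct members one is an element of the other, and (iii) $|N_0|>|N_1|$ whenever $N_0,N_1\in\Sigma$ and $N_0\in N_1$. Let $B$ be a Boolean algebra with $0\neq1$. For a subalgebra $A$ of $B$, say that $B$ \emph{reflects cones to} $A$ if for every $q\in B$ there is $r\in A$ such that for all $p\in A$: $p\ge q$ if and only if $p\ge r$. For $n<\omega$, $B$ \emph{$n$-reflects cones in} $\langle H_\theta,\ldots\rangle$ if for every submodel chain $\Sigma$ in $\langle H_\theta,\ldots\rangle$ with at most $n$ members, $B$ reflects cones to the subalgebra of $B$ generated by $B\cap\bigcup\Sigma$; $B$ \emph{$\omega$-reflects cones in} $\langle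 H_\theta,\ldots\rangle$ if it $n$-reflects cones in $\langle H_\theta,\ldots\rangle$ for every $n<\omega$. Finally, $B$ \emph{$n$-reflects cones} (resp. \emph{$\omega$-reflects cones}) if for all sufficiently large regular $\theta$ it does so in some expansion $\langle H_\theta,\ldots\rangle$. \textbf{Theorem.} (1) If $B$ $\omega$-reflects cones, then $B$ is isomorphic to a subalgebra of a free Boolean algebra. (2) For every $n<\omega$, if $|B|\le\omega_n$ and $B$ $n$-reflects cones, then $B$ is isomorphic to a subalgebra of a free Boolean algebra. -/

import Mathlib

universe u

open scoped Cardinal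

namespace ReflectingCones

/-- The underlying type of `H_θ`: the sets that hereditarily have size less than `θ`. -/
abbrev HSet (θ : Cardinal.{u}) : Type (u + 1) :=
  {x : ZFSet.{u} // x.Hereditarily fun y => y.card < θ}

/-- An expansion `⟨H_θ, ∈, …⟩` of the `{∈}`-structure `H_θ` to an `L`-structure for some countable
first-order language `L` (with a distinguished binary relation symbol for membership). -/
structure Expansion (θ : Cardinal.{u}) where
  L : FirstOrder.Language.{0, 0}
  countable_symbols : Countable L.Symbols
  str : L.Structure (HSet θ)
  memSymb : L.Relations 2
  relMap_memSymb : ∀ v : Fin 2 → HSet θ, str.RelMap memSymb v ↔ (v 0).1 ∈ (v 1).1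

/-- `N ≺ ⟨H_θ, …⟩`: the set `N` is the universe of an elementary substructure. -/
def Expansion.IsElementarySubmodel {θ : Cardinal.{u}} (E : Expansion θ) (N : ZFSet.{u}) : Prop :=
  letI := E.str
  ∃ S : E.L.ElementarySubstructure (HSet θ),
    (Subtype.val '' (S : Set (HSet θ)) : Set ZFSet.{u}) = {x | x ∈ N}

/-- `Σ` satisfies the three requirements
* `|N| ⊆ N ≺ ⟨H_θ, …⟩` for all `N ∈ Σ`, where `|N|` is a von Neumann cardinal;
* `Σ` is an `∈`-chain: any two distinct members are related by `∈`;
* if `N₀, N₁ ∈ Σ` and `N₀ ∈ N₁`, then `|N₀| > |N₁|`. -/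
structure Expansion.IsSubmodelChain {θ : Cardinal.{u}} (E : Expansion θ)
    (S : Finset ZFSet.{u}) : Prop where
  elementary : ∀ N ∈ S, E.IsElementarySubmodel N
  card_subset : ∀ N ∈ S, N.card.ord.toZFSet ⊆ N
  chain : IsChain (fun x y : ZFSet.{u} => x ∈ y) (S : Set ZFSet.{u})
  card_lt : ∀ N₀ ∈ S, ∀ N₁ ∈ S, N₀ ∈ N₁ → N₁.card < N₀.card

/-- The Boolean algebra `B` reflects cones to its subalgebra `A`. -/
def ReflectsConesTo {B : Type u} [BooleanAlgebra B] (A : BooleanSubalgebra B) : Prop :=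
  ∀ q : B, ∃ r ∈ A, ∀ p ∈ A, q ≤ p ↔ r ≤ p

/-- `B`, realized as the set of all `e b`, `n`-reflects cones in `⟨H_θ, …⟩`: for every chain `Σ` as
above with at most `n` members, `B` reflects cones to the subalgebra generated by `B ∩ ⋃ Σ`. -/
def NReflectsConesIn {B : Type u} [BooleanAlgebra B] (e : B ↪ ZFSet.{u}) (n : ℕ)
    {θ : Cardinal.{u}} (E : Expansion θ) : Prop :=
  ∀ S : Finset ZFSet.{u}, S.card ≤ n → E.IsSubmodelChain S →
    ReflectsConesTo (BooleanSubalgebra.closure {b : B | ∃ N ∈ S, e b ∈ N})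

/-- `B` `n`-reflects cones: it does so in some `⟨H_θ, …⟩`, for all sufficiently large regular `θ`.
The type `B` is turned into a set of set theory by an injection `e` into the universe of sets; which
one is irrelevant, since a bijection between two copies can be added to the language. -/
def NReflectsCones (n : ℕ) (B : Type u) [BooleanAlgebra B] : Prop :=
  ∃ e : B ↪ ZFSet.{u}, ∃ θ₀ : Cardinal.{u}, ∀ θ : Cardinal.{u}, θ₀ ≤ θ → θ.IsRegular →
    ∃ E : Expansion θ, NReflectsConesIn e n E

/-- `B` `ω`-reflects cones: for all sufficiently large regular `θ` there is one expansion
`⟨H_θ, …⟩` in which `B` `n`-reflects cones for every `n < ω`. -/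
def OmegaReflectsCones (B : Type u) [BooleanAlgebra B] : Prop :=
  ∃ e : B ↪ ZFSet.{u}, ∃ θ₀ : Cardinal.{u}, ∀ θ : Cardinal.{u}, θ₀ ≤ θ → θ.IsRegular →
    ∃ E : Expansion θ, ∀ n : ℕ, NReflectsConesIn e n E

/-- `F` is a free Boolean algebra: it is free on some family `g` of generators. -/
def IsFreeBooleanAlgebra (F : Type u) [BooleanAlgebra F] : Prop :=
  ∃ (I : Type u) (g : I → F), ∀ (C : Type u) [BooleanAlgebra C] (f : I → C),
    ∃! φ : BoundedLatticeHom F C, ∀ i, φ (g i) = f i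

/-- `B` is (isomorphic to) a subalgebra of a free Boolean algebra. -/
def EmbedsInFreeBooleanAlgebra (B : Type u) [BooleanAlgebra B] : Prop :=
  ∃ (F : Type u) (_ : BooleanAlgebra F), IsFreeBooleanAlgebra F ∧
    ∃ φ : BoundedLatticeHom B F, Function.Injective φ

end ReflectingCones

/-!
Two ideas carry the proof: an embedding criterion for Boolean algebras, and a construction of nested
elementary submodels that supplies what the criterion asks for.

**The criterion.** Say that a subalgebra `A` of `B` is relatively complete if `B` reflects cones to
`A`, that is, if each `q : B` has a least element of `A` above it. Suppose that `B` is generated by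
a well-ordered family `g : I → B` all of whose initial segments generate relatively complete
subalgebras. Then `B` embeds into the free algebra over `I`, the algebra of clopen subsets of the
Cantor cube `2^I`. Dually, there is a continuous surjection from `2^I` onto the Stone space of `B`:
a point `f` guides the construction of an ultrafilter, by recursion along `I`, where `g i` is
declared true or false as the earlier decisions force it, and as `f i` says if they force nothing.
Every ultrafilter is guided by its own truth values, hence surjectivity. The largest elements
below `g i` and below `(g i)ᶜ` in the subalgebra generated by the earlier elements show that "the
earlier decisions force `g i`" is a clopen condition on `f`, hence continuity
(`embedsInFree_of_wellOrdered_generators`).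

**The well-order.** It is obtained together with elementary submodels `N` of `H_θ`, by induction on
`κ = |N|`, in the form relative to a chain `S` of submodels of size at least `κ`: each proper initial
segment of `B ∩ N`, together with `B ∩ ⋃ S`, generates a relatively complete subalgebra
(`exists_isLayered`). For `κ = ω` an enumeration of `N` in order type `ω` works, since adjoining
finitely many elements preserves relative completeness (`ReflectsConesTo.closure_insert`). For
uncountable `κ` the model is a continuous union of models `M β`, `β < κ`. Here `M 0` is layered over
`S`. For `β > 0`, `M β` has size `|β| + ω`, contains the union `U` of the earlier models as an
element, and is layered over the chain `S ∪ {U}`. As `U` is smaller than `κ` and contains all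
members of `S`, this is again a chain of the kind that the induction hypothesis covers. An initial
segment of `⋃ M β` is the union of some `U` and an initial segment of the model following it.

Only chains of infinite submodels smaller than `B` occur. Their members have distinct
cardinalities, so that they number at most `n` if `|B| ≤ ℵ_n`.
-/

namespace ReflectingCones

/-! ### Relatively complete subalgebras -/

section RelativelyComplete

variable {B : Type u} [BooleanAlgebra B]

open BooleanSubalgebra hiding map_sup map_inf map_bot map_top

/-- The elements of `⟨A, x⟩` are those that agree with some element of `A` below `x` and with
another one below `xᶜ`. -/
theorem exists_of_mem_closure_insert {S : Set B} {x p : B} (hp : p ∈ closure (insert x S)) :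
    ∃ a ∈ closure S, ∃ b ∈ closure S, p = a ⊓ x ⊔ b ⊓ xᶜ := by
  induction hp using closure_bot_sup_induction with
  | mem y hy =>
    rcases hy with rfl | hy
    · exact ⟨⊤, top_mem, ⊥, bot_mem, by simp⟩
    · exact ⟨y, subset_closure hy, y, subset_closure hy, by
        rw [← inf_sup_left, sup_compl_eq_top, inf_top_eq]⟩
  | bot => exact ⟨⊥, bot_mem, ⊥, bot_mem, by simp⟩
  | sup y _ z _ hy hz =>
    obtain ⟨a, ha, b, hb, rfl⟩ := hy
    obtain ⟨c, hc, d, hd, rfl⟩ := hz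
    refine ⟨a ⊔ c, sup_mem ha hc, b ⊔ d, sup_mem hb hd, ?_⟩
    rw [inf_sup_right, inf_sup_right]
    ac_rfl
  | compl y _ hy =>
    obtain ⟨a, ha, b, hb, rfl⟩ := hy
    refine ⟨aᶜ, compl_mem ha, bᶜ, compl_mem hb, ?_⟩
    refine compl_unique ?_ ?_
    · simp only [inf_sup_left, inf_sup_right]
      have h1 : a ⊓ x ⊓ (aᶜ ⊓ x) = ⊥ := by
        rw [inf_inf_inf_comm, inf_compl_self, bot_inf_eq]
      have h2 : b ⊓ xᶜ ⊓ (aᶜ ⊓ x) = ⊥ := by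
        rw [inf_inf_inf_comm, compl_inf_self, inf_bot_eq]
      have h3 : a ⊓ x ⊓ (bᶜ ⊓ xᶜ) = ⊥ := by
        rw [inf_inf_inf_comm, inf_compl_self, inf_bot_eq]
      have h4 : b ⊓ xᶜ ⊓ (bᶜ ⊓ xᶜ) = ⊥ := by
        rw [inf_inf_inf_comm, inf_compl_self, bot_inf_eq]
      rw [h1, h2, h3, h4]; simp
    · calc a ⊓ x ⊔ b ⊓ xᶜ ⊔ (aᶜ ⊓ x ⊔ bᶜ ⊓ xᶜ)
          = (a ⊔ aᶜ) ⊓ x ⊔ (b ⊔ bᶜ) ⊓ xᶜ := by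
            rw [inf_sup_right, inf_sup_right]; ac_rfl
        _ = ⊤ := by simp

/-- Relative completeness survives the adjunction of one element `x`: the least element of
`⟨A, x⟩` above `q` is computed separately below `x` and below `xᶜ`. -/
theorem ReflectsConesTo.closure_insert {S : Set B} (h : ReflectsConesTo (closure S)) (x : B) :
    ReflectsConesTo (closure (insert x S)) := by
  intro q
  obtain ⟨r, hr, hr'⟩ := h (q ⊓ x)
  obtain ⟨t, ht, ht'⟩ := h (q ⊓ xᶜ)
  have hx : x ∈ closure (insert x S) := subset_closure (Set.mem_insert _ _)
  have hS : closure S ≤ closure (insert x S) := closure_mono (Set.subset_insert _ _)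
  refine ⟨r ⊓ x ⊔ t ⊓ xᶜ, sup_mem (inf_mem (hS hr) hx) (inf_mem (hS ht) (compl_mem hx)), ?_⟩
  intro p hp
  constructor
  · intro hq
    obtain ⟨a, ha, b, hb, rfl⟩ := exists_of_mem_closure_insert hp
    refine sup_le_sup (inf_le_inf_right _ ((hr' a ha).1 ?_)) (inf_le_inf_right _ ((ht' b hb).1 ?_))
    · calc q ⊓ x ≤ (a ⊓ x ⊔ b ⊓ xᶜ) ⊓ x := inf_le_inf_right _ hq
        _ = a ⊓ x := by rw [inf_sup_right, inf_assoc, inf_assoc]; simp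
        _ ≤ a := inf_le_left
    · calc q ⊓ xᶜ ≤ (a ⊓ x ⊔ b ⊓ xᶜ) ⊓ xᶜ := inf_le_inf_right _ hq
        _ = b ⊓ xᶜ := by rw [inf_sup_right, inf_assoc, inf_assoc]; simp
        _ ≤ b := inf_le_left
  · intro hrp
    refine le_trans ?_ hrp
    calc q = q ⊓ x ⊔ q ⊓ xᶜ := by rw [← inf_sup_left, sup_compl_eq_top, inf_top_eq]
      _ ≤ _ := sup_le_sup (le_inf ((hr' r hr).2 le_rfl) inf_le_right)
        (le_inf ((ht' t ht).2 le_rfl) inf_le_right)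

theorem ReflectsConesTo.closure_union_finite {S F : Set B} (h : ReflectsConesTo (closure S))
    (hF : F.Finite) : ReflectsConesTo (closure (S ∪ F)) := by
  induction F, hF using Set.Finite.induction_on with
  | empty => simpa using h
  | insert _ _ ih => rw [Set.union_insert]; exact ih.closure_insert _

end RelativelyComplete

/-! ### Two-valued homomorphisms -/

section Ultrafilters

variable {B : Type u} [BooleanAlgebra B]

/-- Two-valued homomorphisms separate points from `⊥`. -/
theorem exists_hom_prop {b : B} (hb : b ≠ ⊥) : ∃ u : BoundedLatticeHom B Prop, u b := by
  obtain ⟨J, hJ, -, hd⟩ := DistribLattice.prime_ideal_of_disjoint_filter_ideal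
    (F := Order.PFilter.principal b) (I := Order.Ideal.principal (⊥ : B)) (by
      rw [Set.disjoint_left]
      intro x hx hx'
      simp only [SetLike.mem_coe, Order.PFilter.mem_principal, Order.Ideal.mem_principal] at hx hx'
      exact hb (le_bot_iff.1 (hx.trans hx')))
  refine ⟨{ toFun := fun x => x ∉ J, map_sup' := ?_, map_inf' := ?_, map_top' := ?_,
            map_bot' := ?_ }, ?_⟩
  · intro x y
    simp only [sup_Prop_eq, eq_iff_iff, Order.Ideal.sup_mem_iff]
    tauto
  · intro x y
    have h1 := @Order.Ideal.IsPrime.mem_or_mem _ _ J hJ x y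
    have h2 : x ∈ J → x ⊓ y ∈ J := J.lower inf_le_left
    have h3 : y ∈ J → x ⊓ y ∈ J := J.lower inf_le_right
    simp only [inf_Prop_eq, eq_iff_iff]
    tauto
  · simpa using fun h => hJ.toIsProper.top_notMem h
  · simp
  · exact Set.disjoint_left.1 hd (by simp)

theorem hom_prop_compl (u : BoundedLatticeHom B Prop) (b : B) : u bᶜ ↔ ¬ u b := by
  rw [map_compl' u b]; rfl

theorem eq_of_forall_hom_prop {a b : B} (h : ∀ u : BoundedLatticeHom B Prop, u a ↔ u b) :
    a = b := by
  have key : ∀ {a b : B}, (∀ u : BoundedLatticeHom B Prop, u a ↔ u b) → a ≤ b := by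
    intro a b h
    rw [← sdiff_eq_bot_iff, sdiff_eq]
    by_contra hne
    obtain ⟨u, hu⟩ := exists_hom_prop hne
    rw [map_inf, hom_prop_compl] at hu
    exact hu.2 ((h u).1 hu.1)
  exact le_antisymm (key h) (key fun u => (h u).symm)

end Ultrafilters

/-! ### The free Boolean algebra of a Cantor cube -/

section FreeAlgebra

open BooleanSubalgebra hiding map_sup map_inf map_bot map_top

/-- The algebra of the subsets of the Cantor cube `2^I` generated by the coordinate sets; these are
the clopen sets. -/
abbrev CubeAlgebra (I : Type u) : BooleanSubalgebra (Set (I → Prop)) :=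
  closure (Set.range fun i : I => {f : I → Prop | f i})

theorem coordinate_mem_cubeAlgebra {I : Type u} (i : I) :
    {f : I → Prop | f i} ∈ CubeAlgebra I := subset_closure ⟨i, rfl⟩

theorem hom_ext_of_closure {A C : Type u} [BooleanAlgebra A] [BooleanAlgebra C] {s : Set A}
    {φ ψ : BoundedLatticeHom (closure s) C}
    (h : ∀ x (hx : x ∈ s), φ ⟨x, subset_closure hx⟩ = ψ ⟨x, subset_closure hx⟩) : φ = ψ := by
  ext ⟨x, hx⟩
  induction hx using closure_bot_sup_induction with
  | mem x hx => exact h x hx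
  | bot => exact (map_bot φ).trans (map_bot ψ).symm
  | sup x hx y hy ihx ihy =>
    have key : ∀ χ : BoundedLatticeHom (closure s) C,
        χ (⟨x, hx⟩ ⊔ ⟨y, hy⟩) = χ ⟨x, hx⟩ ⊔ χ ⟨y, hy⟩ := fun χ => map_sup χ _ _
    exact (key φ).trans ((congrArg₂ (· ⊔ ·) ihx ihy).trans (key ψ).symm)
  | compl x hx ih =>
    have h1 := map_compl' φ (⟨x, hx⟩ : closure s)
    rw [ih, ← map_compl'] at h1
    exact h1

/-- For `f : I → C`, the ultrafilters of `C` map to `2^I` by composition with `f`, and the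
preimage of a clopen set under this map is the set of ultrafilters containing some element of `C`.
That element is the value of the homomorphism extending `f`. -/
theorem isFree_cubeAlgebra (I : Type u) : IsFreeBooleanAlgebra (CubeAlgebra I) := by
  refine ⟨I, fun i => ⟨_, coordinate_mem_cubeAlgebra i⟩, fun C _ f => ?_⟩
  have key : ∀ x ∈ CubeAlgebra I, ∃ c : C, ∀ u : BoundedLatticeHom C Prop,
      u c ↔ (fun i => u (f i)) ∈ x := by
    intro x hx
    induction hx using closure_bot_sup_induction with
    | mem x hx =>
      obtain ⟨i, rfl⟩ := hx
      exact ⟨f i, fun u => Iff.rfl⟩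
    | bot => exact ⟨⊥, fun u => by simp⟩
    | sup x _ y _ ihx ihy =>
      obtain ⟨c, hc⟩ := ihx
      obtain ⟨d, hd⟩ := ihy
      exact ⟨c ⊔ d, fun u => by rw [map_sup]; exact or_congr (hc u) (hd u)⟩
    | compl x _ ih =>
      obtain ⟨c, hc⟩ := ih
      exact ⟨cᶜ, fun u => by rw [hom_prop_compl, hc]; rfl⟩
  choose val hval using key
  have uniq : ∀ (x : CubeAlgebra I) (c : C),
      (∀ u : BoundedLatticeHom C Prop, u c ↔ (fun i => u (f i)) ∈ x.1) → val x.1 x.2 = c :=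
    fun x c hc => eq_of_forall_hom_prop fun u => (hval _ _ u).trans (hc u).symm
  refine ⟨{ toFun := fun x => val x.1 x.2, map_sup' := ?_, map_inf' := ?_, map_top' := ?_,
            map_bot' := ?_ }, ?_, ?_⟩
  · intro x y
    refine uniq _ _ fun u => ?_
    rw [map_sup]; exact or_congr (hval _ _ u) (hval _ _ u)
  · intro x y
    refine uniq _ _ fun u => ?_
    rw [map_inf]; exact and_congr (hval _ _ u) (hval _ _ u)
  · exact uniq _ _ fun u => by simp
  · exact uniq _ _ fun u => by simp
  · exact fun i => uniq _ _ fun u => Iff.rfl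
  · intro ψ hψ
    refine hom_ext_of_closure ?_
    rintro _ ⟨i, rfl⟩
    exact (hψ i).trans (uniq ⟨_, coordinate_mem_cubeAlgebra i⟩ _ fun u => Iff.rfl).symm

end FreeAlgebra

/-! ### Ultrafilters guided by points of the Cantor cube -/

section GuidedUltrafilter

open BooleanSubalgebra hiding map_sup map_inf map_bot map_top

variable {B : Type u} [BooleanAlgebra B] {I : Type u} [LinearOrder I] [WellFoundedLT I]

open Classical in
/-- The truth values assigned to the elements `g i` by recursion on `i`: the value at `g i` is the
one forced by the values at earlier elements, if they force one, and `f i` otherwise. -/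
noncomputable def guidedValue (g : I → B) (f : I → Prop) : I → Prop :=
  wellFounded_lt.fix fun i rec =>
    (∃ s : Finset (Set.Iio i),
        (s.inf fun j => if rec j.1 j.2 then g j.1 else (g j.1)ᶜ) ≤ g i) ∨
      f i ∧ ¬ ∃ s : Finset (Set.Iio i),
        (s.inf fun j => if rec j.1 j.2 then g j.1 else (g j.1)ᶜ) ≤ (g i)ᶜ

open Classical in
/-- The element `g i` or its complement, whichever the guided value declares true. -/
noncomputable def literal (g : I → B) (f : I → Prop) (i : I) : B :=
  if guidedValue g f i then g i else (g i)ᶜ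

theorem guidedValue_iff (g : I → B) (f : I → Prop) (i : I) :
    guidedValue g f i ↔
      (∃ s : Finset I, (∀ j ∈ s, j < i) ∧ s.inf (literal g f) ≤ g i) ∨
        f i ∧ ¬ ∃ s : Finset I, (∀ j ∈ s, j < i) ∧ s.inf (literal g f) ≤ (g i)ᶜ := by
  classical
  have key : ∀ b : B, (∃ s : Finset (Set.Iio i), (s.inf fun j => literal g f j.1) ≤ b) ↔
      ∃ s : Finset I, (∀ j ∈ s, j < i) ∧ s.inf (literal g f) ≤ b := by
    intro b
    constructor
    · rintro ⟨s, hs⟩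
      refine ⟨s.image Subtype.val, ?_, ?_⟩
      · intro j hj
        obtain ⟨k, -, rfl⟩ := Finset.mem_image.1 hj
        exact k.2
      · rwa [Finset.inf_image]
    · rintro ⟨s, hs, hb⟩
      refine ⟨s.subtype (· ∈ Set.Iio i), le_trans (Finset.le_inf fun j hj => ?_) hb⟩
      exact Finset.inf_le (f := fun j : Set.Iio i => literal g f j.1) (b := ⟨j, hs j hj⟩)
        (by simpa using hj)
  rw [← key, ← key]
  conv_lhs => rw [guidedValue, WellFounded.fix_eq]
  rfl

/-- Membership in the filter generated by the literals. -/
def guidedFilter (g : I → B) (f : I → Prop) (b : B) : Prop :=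
  ∃ s : Finset I, s.inf (literal g f) ≤ b

variable {g : I → B} {f : I → Prop}

theorem guidedFilter_literal (i : I) : guidedFilter g f (literal g f i) := ⟨{i}, by simp⟩

theorem guidedFilter.mono {a b : B} (h : guidedFilter g f a) (hab : a ≤ b) : guidedFilter g f b :=
  h.imp fun _ hs => hs.trans hab

theorem guidedFilter.inf {a b : B} (ha : guidedFilter g f a) (hb : guidedFilter g f b) :
    guidedFilter g f (a ⊓ b) := by
  classical
  obtain ⟨s, hs⟩ := ha
  obtain ⟨t, ht⟩ := hb
  exact ⟨s ∪ t, by rw [Finset.inf_union]; exact inf_le_inf hs ht⟩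

/-- The literals have the finite intersection property: `g i` is declared true when the earlier
literals force it, and otherwise only if they do not force its complement. -/
theorem inf_literal_ne_bot_of_le [Nontrivial B] (i : I) :
    ∀ s : Finset I, (∀ j ∈ s, j ≤ i) → s.inf (literal g f) ≠ ⊥ := by
  classical
  induction i using WellFoundedLT.induction with
  | ind i ih =>
    have below : ∀ s : Finset I, (∀ j ∈ s, j < i) → s.inf (literal g f) ≠ ⊥ := by
      intro s hs
      rcases s.eq_empty_or_nonempty with rfl | hne
      · simp
      · exact ih _ (hs _ (s.max'_mem hne)) s fun j hj => s.le_max' j hj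
    have step : ∀ s : Finset I, (∀ j ∈ s, j < i) → ¬ literal g f i ⊓ s.inf (literal g f) = ⊥ := by
      intro s hs h
      by_cases hv : guidedValue g f i
      · rw [literal, if_pos hv, ← le_compl_iff_disjoint_left.trans disjoint_iff] at h
        rcases (guidedValue_iff g f i).1 hv with ⟨t, ht, htb⟩ | ⟨-, hn⟩
        · refine below (s ∪ t) ?_ ?_
          · intro j hj
            rcases Finset.mem_union.1 hj with hj | hj
            exacts [hs j hj, ht j hj]
          · rw [Finset.inf_union, ← le_bot_iff]
            exact (inf_le_inf h htb).trans (by simp)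
        · exact hn ⟨s, hs, h⟩
      · rw [literal, if_neg hv, ← le_compl_iff_disjoint_left.trans disjoint_iff, compl_compl] at h
        exact hv ((guidedValue_iff g f i).2 (Or.inl ⟨s, hs, h⟩))
    intro s hs
    by_cases hi : i ∈ s
    · rw [← Finset.insert_erase hi, Finset.inf_insert]
      refine step _ fun j hj => ?_
      exact lt_of_le_of_ne (hs j (Finset.mem_of_mem_erase hj)) (Finset.ne_of_mem_erase hj)
    · exact below s fun j hj => lt_of_le_of_ne (hs j hj) fun h => hi (h ▸ hj)

theorem not_guidedFilter_bot [Nontrivial B] : ¬ guidedFilter g f ⊥ := by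
  rintro ⟨s, hs⟩
  rcases s.eq_empty_or_nonempty with rfl | hne
  · simp at hs
  · exact inf_literal_ne_bot_of_le (s.max' hne) s (fun j hj => s.le_max' j hj) (le_bot_iff.1 hs)

theorem guidedFilter_compl_or (hg : closure (Set.range g) = ⊤) (b : B) :
    guidedFilter g f b ∨ guidedFilter g f bᶜ := by
  have hb : b ∈ closure (Set.range g) := by rw [hg]; exact mem_top
  induction hb using closure_bot_sup_induction with
  | mem b hb =>
    obtain ⟨i, rfl⟩ := hb
    have := guidedFilter_literal (g := g) (f := f) i
    rw [literal] at this
    split_ifs at this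
    exacts [Or.inl this, Or.inr this]
  | bot => exact Or.inr ⟨∅, by simp⟩
  | sup x _ y _ hx hy =>
    rcases hx with hx | hx
    · exact Or.inl (hx.mono le_sup_left)
    rcases hy with hy | hy
    · exact Or.inl (hy.mono le_sup_right)
    · exact Or.inr (by rw [compl_sup]; exact hx.inf hy)
  | compl x _ hx => rwa [compl_compl, or_comm]

theorem guidedFilter_compl [Nontrivial B] (hg : closure (Set.range g) = ⊤) (b : B) :
    guidedFilter g f bᶜ ↔ ¬ guidedFilter g f b := by
  refine ⟨fun h h' => not_guidedFilter_bot (g := g) (f := f) ?_, fun h =>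
    (guidedFilter_compl_or hg b).resolve_left h⟩
  simpa using h'.inf h

theorem guidedFilter_inf {a b : B} :
    guidedFilter g f (a ⊓ b) ↔ guidedFilter g f a ∧ guidedFilter g f b :=
  ⟨fun h => ⟨h.mono inf_le_left, h.mono inf_le_right⟩, fun h => h.1.inf h.2⟩

theorem guidedFilter_sup [Nontrivial B] (hg : closure (Set.range g) = ⊤) {a b : B} :
    guidedFilter g f (a ⊔ b) ↔ guidedFilter g f a ∨ guidedFilter g f b := by
  rw [← compl_compl (a ⊔ b), guidedFilter_compl hg, compl_sup, guidedFilter_inf,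
    guidedFilter_compl hg, guidedFilter_compl hg]
  tauto

theorem guidedFilter_apply_iff [Nontrivial B] (hg : closure (Set.range g) = ⊤) (i : I) :
    guidedFilter g f (g i) ↔ guidedValue g f i := by
  have h := guidedFilter_literal (g := g) (f := f) i
  rw [literal] at h
  split_ifs at h with hv
  · exact iff_of_true h hv
  · exact iff_of_false ((guidedFilter_compl hg _).1 h) hv

theorem inf_literal_mem_closure {i : I} {s : Finset I} (hs : ∀ j ∈ s, j < i) :
    s.inf (literal g f) ∈ closure (g '' Set.Iio i) := by
  classical
  induction s using Finset.induction_on with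
  | empty => simp
  | insert j s _ ih =>
    rw [Finset.inf_insert]
    refine inf_mem ?_ (ih fun k hk => hs k (Finset.mem_insert_of_mem hk))
    have : g j ∈ closure (g '' Set.Iio i) :=
      subset_closure ⟨j, hs j (Finset.mem_insert_self _ _), rfl⟩
    rw [literal]
    split_ifs
    exacts [this, compl_mem this]

/-- When every initial segment generates a relatively complete subalgebra, membership in the guided
filter depends on finitely many coordinates of `f`. -/
theorem guidedFilter_mem_cubeAlgebra [Nontrivial B] (hg : closure (Set.range g) = ⊤)
    (hrc : ∀ i, ReflectsConesTo (closure (g '' Set.Iio i))) (b : B) :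
    {f | guidedFilter g f b} ∈ CubeAlgebra I := by
  -- Dependence on finitely many coordinates passes from a set to the subalgebra it generates.
  have extend : ∀ S : Set B, (∀ b ∈ S, {f | guidedFilter g f b} ∈ CubeAlgebra I) →
      ∀ b ∈ closure S, {f | guidedFilter g f b} ∈ CubeAlgebra I := by
    intro S hS b hb
    induction hb using closure_bot_sup_induction with
    | mem b hb => exact hS b hb
    | bot =>
      convert bot_mem (L := CubeAlgebra I)
      exact Set.eq_empty_of_forall_notMem fun f => not_guidedFilter_bot
    | sup x _ y _ hx hy =>
      convert sup_mem hx hy using 1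
      ext f
      exact guidedFilter_sup hg
    | compl x _ hx =>
      convert compl_mem hx using 1
      ext f
      exact guidedFilter_compl hg x
  refine extend (Set.range g) ?_ b (by rw [hg]; exact mem_top)
  rintro _ ⟨i, rfl⟩
  induction i using WellFoundedLT.induction with
  | ind i ih =>
    have below := extend (g '' Set.Iio i) (by rintro _ ⟨j, hj, rfl⟩; exact ih j hj)
    -- `rᶜ` and `tᶜ` are the largest elements of the earlier subalgebra below `(g i)ᶜ` and `g i`.
    obtain ⟨r, hr, hr'⟩ := hrc i (g i)
    obtain ⟨t, ht, ht'⟩ := hrc i (g i)ᶜ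
    have hri : g i ≤ r := (hr' r hr).2 le_rfl
    have hti : tᶜ ≤ g i := compl_le_of_compl_le ((ht' t ht).2 le_rfl)
    convert sup_mem (below _ (compl_mem ht))
      (inf_mem (coordinate_mem_cubeAlgebra i) (below _ hr)) using 1
    ext f
    change guidedFilter g f (g i) ↔ guidedFilter g f tᶜ ∨ f i ∧ guidedFilter g f r
    constructor
    · intro h
      rcases (guidedValue_iff g f i).1 ((guidedFilter_apply_iff hg i).1 h) with
        ⟨s, hs, hsi⟩ | ⟨hf, -⟩
      · left
        refine ⟨s, ?_⟩
        rw [← compl_le_compl_iff_le, compl_compl]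
        exact (ht' _ (compl_mem (inf_literal_mem_closure hs))).1 (compl_le_compl hsi)
      · exact Or.inr ⟨hf, h.mono hri⟩
    · rintro (h | ⟨hf, h⟩)
      · exact h.mono hti
      · rw [guidedFilter_apply_iff hg, guidedValue_iff]
        refine Or.inr ⟨hf, ?_⟩
        rintro ⟨s, hs, hsi⟩
        refine not_guidedFilter_bot (g := g) (f := f) ?_
        have hsr : s.inf (literal g f) ≤ rᶜ := by
          rw [← compl_le_compl_iff_le, compl_compl]
          exact (hr' _ (compl_mem (inf_literal_mem_closure hs))).1 (le_compl_comm.1 hsi)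
        simpa using h.inf ⟨s, hsr⟩

/-- Every ultrafilter is the one guided by itself. -/
theorem guidedFilter_hom [Nontrivial B] (hg : closure (Set.range g) = ⊤)
    (u : BoundedLatticeHom B Prop) (b : B) : guidedFilter g (fun i => u (g i)) b ↔ u b := by
  classical
  set f : I → Prop := fun i => u (g i)
  have hmono : ∀ {a b : B}, a ≤ b → u a → u b := fun h => OrderHomClass.mono u h
  have hinf : ∀ s : Finset I, (∀ j ∈ s, u (literal g f j)) → u (s.inf (literal g f)) := by
    intro s hs
    induction s using Finset.induction_on with
    | empty => simp
    | insert j s _ ih =>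
      rw [Finset.inf_insert, map_inf]
      exact ⟨hs j (Finset.mem_insert_self _ _),
        ih fun k hk => hs k (Finset.mem_insert_of_mem hk)⟩
  have hlit : ∀ i, u (literal g f i) := by
    intro i
    induction i using WellFoundedLT.induction with
    | ind i ih =>
      rw [literal]
      split_ifs with hv
      · rcases (guidedValue_iff g f i).1 hv with ⟨s, hs, hsi⟩ | ⟨hf, -⟩
        · exact hmono hsi (hinf s fun j hj => ih j (hs j hj))
        · exact hf
      · rw [hom_prop_compl]
        intro hu
        refine hv ((guidedValue_iff g f i).2 (Or.inr ⟨hu, ?_⟩))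
        rintro ⟨s, hs, hsi⟩
        exact (hom_prop_compl u _).1 (hmono hsi (hinf s fun j hj => ih j (hs j hj))) hu
  have hle : ∀ b, guidedFilter g f b → u b := fun b ⟨s, hs⟩ => hmono hs (hinf s fun j _ => hlit j)
  refine ⟨hle b, fun hb => ?_⟩
  by_contra hn
  exact (hom_prop_compl u b).1 (hle _ ((guidedFilter_compl hg b).2 hn)) hb

/-- An algebra with a well-ordered family of generators, all of whose initial segments generate
relatively complete subalgebras, embeds into the free algebra over the index set. Dually, `f ↦ {b |
guidedFilter g f b}` maps the Cantor cube `2^I` continuously onto the Stone space of `B`. -/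
theorem embedsInFree_of_wellOrdered_generators [Nontrivial B]
    (hg : closure (Set.range g) = ⊤) (hrc : ∀ i, ReflectsConesTo (closure (g '' Set.Iio i))) :
    EmbedsInFreeBooleanAlgebra B := by
  refine ⟨CubeAlgebra I, inferInstance, isFree_cubeAlgebra I,
    { toFun := fun b => ⟨_, guidedFilter_mem_cubeAlgebra hg hrc b⟩, map_sup' := ?_, map_inf' := ?_,
      map_top' := ?_, map_bot' := ?_ }, ?_⟩
  · exact fun a b => Subtype.ext (Set.ext fun f => guidedFilter_sup hg)
  · exact fun a b => Subtype.ext (Set.ext fun f => guidedFilter_inf)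
  · exact Subtype.ext (Set.eq_univ_of_forall fun f => ⟨∅, by simp⟩)
  · exact Subtype.ext (Set.eq_empty_of_forall_notMem fun f => not_guidedFilter_bot)
  · intro a b hab
    refine eq_of_forall_hom_prop fun u => ?_
    rw [← guidedFilter_hom hg u a, ← guidedFilter_hom hg u b]
    exact Set.ext_iff.1 (congrArg Subtype.val hab) _

end GuidedUltrafilter

/-- The criterion for a well-order given as a relation, which allows `I` to be `B` itself in spite of
its Boolean order. -/
theorem embedsInFree_of_isWellOrder {B I : Type u} [BooleanAlgebra B] [Nontrivial B] {g : I → B}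
    (r : I → I → Prop) [hr : IsWellOrder I r]
    (hg : BooleanSubalgebra.closure (Set.range g) = ⊤)
    (hrc : ∀ i, ReflectsConesTo (BooleanSubalgebra.closure (g '' {j | r j i}))) :
    EmbedsInFreeBooleanAlgebra B := by
  let : LinearOrder I := IsWellOrder.linearOrder r
  have : WellFoundedLT I := ⟨hr.wf⟩
  exact embedsInFree_of_wellOrdered_generators hg hrc

open Cardinal

open Cardinal

/-! ### Elements of `H_θ` -/

section HereditarilySmall

theorem hereditarily_of_forall_mem {θ : Cardinal.{u}} {N : ZFSet.{u}} (hc : N.card < θ)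
    (h : ∀ x ∈ N, x.Hereditarily fun y => y.card < θ) : N.Hereditarily fun y => y.card < θ :=
  ZFSet.hereditarily_iff.2 ⟨hc, h⟩

theorem hereditarily_toZFSet {θ : Cardinal.{u}} (α : Ordinal.{u}) (hα : α < θ.ord) :
    α.toZFSet.Hereditarily fun y => y.card < θ := by
  induction α using WellFoundedLT.induction with
  | ind α ih =>
    refine hereditarily_of_forall_mem ?_ ?_
    · rwa [Ordinal.card_toZFSet, ← lt_ord]
    · intro x hx
      obtain ⟨a, ha, rfl⟩ := Ordinal.mem_toZFSet_iff.1 hx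
      exact ih a ha (ha.trans hα)

/-- Every set lies in `H_θ` for all sufficiently large `θ`. -/
theorem exists_hereditarily (x : ZFSet.{u}) :
    ∃ c : Cardinal.{u}, ∀ θ, c ≤ θ → x.Hereditarily fun y => y.card < θ := by
  induction x using ZFSet.inductionOn with
  | _ x ih =>
    choose! c hc using ih
    refine ⟨max (Order.succ x.card) (⨆ y : x, c y.1), fun θ hθ => ?_⟩
    refine hereditarily_of_forall_mem (Order.succ_le_iff.1 ((le_max_left _ _).trans hθ)) ?_
    intro y hy
    refine hc y hy θ (le_trans ?_ ((le_max_right _ _).trans hθ))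
    exact le_ciSup (f := fun y : x => c y.1) (bddAbove_of_small) ⟨y, hy⟩

end HereditarilySmall

/-! ### Existence and unions of elementary submodels -/

section ElementarySubmodels

variable {θ : Cardinal.{u}} (E : Expansion θ)

theorem Expansion.IsElementarySubmodel.hereditarily {E : Expansion θ} {N x : ZFSet.{u}}
    (h : E.IsElementarySubmodel N) (hx : x ∈ N) : x.Hereditarily fun y => y.card < θ := by
  obtain ⟨S, hS⟩ := h
  have : x ∈ {x | x ∈ N} := hx
  rw [← hS] at this
  obtain ⟨y, -, rfl⟩ := this
  exact y.2

/-- The downward Löwenheim–Skolem theorem, with `|N| ⊆ N`. -/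
theorem Expansion.exists_elementarySubmodel {κ : Cardinal.{u}} (hκ : ℵ₀ ≤ κ) (hκθ : κ < θ)
    {X : Set ZFSet.{u}} (hXκ : #X ≤ lift.{u + 1} κ)
    (hX : ∀ x ∈ X, x.Hereditarily fun y => y.card < θ) :
    ∃ N : ZFSet.{u}, X ⊆ {x | x ∈ N} ∧ E.IsElementarySubmodel N ∧ N.card = κ ∧
      κ.ord.toZFSet ⊆ N := by
  let := E.str
  have hord : #{x | x ∈ κ.ord.toZFSet} = lift.{u + 1} κ := by
    have := ZFSet.cardinalMk_coe_sort (x := κ.ord.toZFSet)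
    rw [Ordinal.card_toZFSet, card_ord] at this
    exact this
  set Y : Set ZFSet.{u} := X ∪ {x | x ∈ κ.ord.toZFSet}
  have hYθ : ∀ x ∈ Y, x.Hereditarily fun y => y.card < θ := by
    rintro x (hx | hx)
    · exact hX x hx
    · obtain ⟨a, ha, rfl⟩ := Ordinal.mem_toZFSet_iff.1 hx
      exact hereditarily_toZFSet a (ha.trans (ord_lt_ord.2 hκθ))
  have hYκ : #Y ≤ lift.{u + 1} κ := by
    refine (mk_union_le _ _).trans ?_
    rw [hord]
    exact (add_le_add_left hXκ _).trans (add_eq_self (by simpa using hκ)).le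
  set s : Set (HSet θ) := Subtype.val ⁻¹' Y
  have hsY : #s = #Y := by
    refine mk_preimage_of_injective_of_subset_range _ _ Subtype.val_injective ?_
    exact fun x hx => ⟨⟨x, hYθ x hx⟩, rfl⟩
  have hκH : lift.{u + 1} κ ≤ #(HSet θ) := by
    rw [← hord]
    refine (mk_le_mk_of_subset (show {x | x ∈ κ.ord.toZFSet} ⊆ Y from
      Set.subset_union_right)).trans ?_
    rw [← hsY]
    exact mk_set_le s
  have hL : E.L.card ≤ ℵ₀ := by
    rw [FirstOrder.Language.card, mk_le_aleph0_iff]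
    exact E.countable_symbols
  obtain ⟨S, hsS, hScard⟩ := FirstOrder.Language.exists_elementarySubstructure_card_eq E.L s κ hκ
    (by rw [hsY, lift_id'.{u, u + 1}]; exact hYκ)
    ((lift_le_aleph0.2 hL).trans (by simpa using hκ))
    (by rw [lift_id'.{u, u + 1}]; exact hκH)
  rw [lift_id'.{u, u + 1}] at hScard
  have hsmall : Small.{u} S := by
    rw [← mk_out κ, ← lift_id'.{u, u + 1} #S, lift_mk_eq'] at hScard
    exact ⟨κ.out, hScard⟩
  have hmem : ∀ x : ZFSet.{u}, x ∈ ZFSet.range (fun x : S => x.1.1) ↔ ∃ z ∈ S, z.1 = x := by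
    intro x
    simp only [ZFSet.mem_range, Subtype.exists, exists_prop]
    
  refine ⟨ZFSet.range fun x : S => x.1.1, ?_, ⟨S, ?_⟩, ?_, ?_⟩
  · intro x hx
    exact (hmem x).2 ⟨⟨x, hYθ x (Or.inl hx)⟩, hsS (Or.inl hx), rfl⟩
  · ext x
    exact (hmem x).symm
  · rw [← lift_inj.{u, u + 1}, ← ZFSet.cardinalMk_coe_sort, ← hScard]
    have : ((ZFSet.range fun x : S => x.1.1 : ZFSet.{u}) : Set ZFSet.{u}) =
        Subtype.val '' (S : Set (HSet θ)) := by
      ext x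
      exact hmem x
    change #((ZFSet.range fun x : S => x.1.1 : ZFSet.{u}) : Set ZFSet.{u}) = _
    rw [this, mk_image_eq Subtype.val_injective]
    rfl
  · intro x hx
    exact (hmem x).2 ⟨⟨x, hYθ x (Or.inr hx)⟩, hsS (Or.inr hx), rfl⟩

/-- Tarski's theorem on elementary chains, for directed unions. -/
theorem Expansion.IsElementarySubmodel.iUnion {E : Expansion θ} {ι : Type*} [Small.{u} ι]
    [Nonempty ι] {f : ι → ZFSet.{u}} (hf : Directed (· ⊆ ·) f)
    (h : ∀ i, E.IsElementarySubmodel (f i)) :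
    E.IsElementarySubmodel (ZFSet.iUnion f) := by
  let := E.str
  choose S hS using h
  have hmem : ∀ i (z : HSet θ), z ∈ S i ↔ z.1 ∈ f i := by
    intro i z
    rw [← SetLike.mem_coe, ← Subtype.val_injective.mem_set_image, hS]
    rfl
  have hdir : ∀ {n : ℕ} (v : Fin n → HSet θ), (∀ k, (v k).1 ∈ ZFSet.iUnion f) →
      ∃ i, ∀ k, v k ∈ S i := by
    intro n v hv
    choose j hj using fun k => ZFSet.mem_iUnion.1 (hv k)
    obtain ⟨i, hi⟩ := hf.finite_le j
    exact ⟨i, fun k => (hmem i _).2 (hi k (hj k))⟩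
  let T : E.L.Substructure (HSet θ) :=
    { carrier := {z | z.1 ∈ ZFSet.iUnion f}
      fun_mem := by
        intro n φ v hv
        obtain ⟨i, hi⟩ := hdir v hv
        exact ZFSet.mem_iUnion.2 ⟨i, (hmem i _).1 ((S i).toSubstructure.fun_mem φ v hi)⟩ }
  refine ⟨T.toElementarySubstructure ?_, ?_⟩
  · intro n φ x a ha
    obtain ⟨i, hi⟩ := hdir (fun k => (x k).1) fun k => (x k).2
    let x' : Fin n → S i := fun k => ⟨(x k).1, hi k⟩
    -- The existential statement satisfied by `x` holds in `S i` too, and the witness found there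
    -- serves in the union.
    have key : (φ.ex).Realize (default : Empty → S i) x' := by
      rw [← (S i).subtype.map_boundedFormula, Subsingleton.elim (_ ∘ default) default]
      exact FirstOrder.Language.BoundedFormula.realize_ex.2 ⟨a, ha⟩
    obtain ⟨b, hb⟩ := FirstOrder.Language.BoundedFormula.realize_ex.1 key
    rw [← (S i).subtype.map_boundedFormula, Subsingleton.elim (_ ∘ default) default,
      Fin.comp_snoc] at hb
    exact ⟨⟨b.1, ZFSet.mem_iUnion.2 ⟨i, (hmem i _).1 b.2⟩⟩, hb⟩
  · ext x
    constructor
    · rintro ⟨z, hz, rfl⟩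
      exact hz
    · intro hx
      obtain ⟨i, hi⟩ := ZFSet.mem_iUnion.1 hx
      have : x ∈ {x | x ∈ f i} := hi
      rw [← hS] at this
      obtain ⟨z, hz, rfl⟩ := this
      exact ⟨z, hx, rfl⟩

end ElementarySubmodels

/-! ### Lexicographic well-orders -/

section LexicographicOrder

/-- Order elements by `ρ`, and those with the same value `w` of `ρ` by `s w`. -/
theorem isWellOrder_lex {V W : Type*} [LinearOrder W] [WellFoundedLT W] (ρ : V → W)
    (s : W → V → V → Prop) (hs : ∀ w, IsWellOrder V (s w)) :
    IsWellOrder V fun x y => ρ x < ρ y ∨ ρ x = ρ y ∧ s (ρ y) x y := by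
  refine { wf := ⟨fun x => ?_⟩, trichotomous := ?_ }
  · generalize hw : ρ x = w
    induction w using WellFoundedLT.induction generalizing x with
    | ind w ih =>
      induction x using (hs w).wf.induction with
      | _ x ihx =>
        refine ⟨_, ?_⟩
        rintro y (hy | ⟨hy, hyx⟩)
        · exact ih (ρ y) (hw ▸ hy) y rfl
        · rw [hw] at hyx
          exact ihx y hyx (hy.trans hw)
  · intro x y hxy hyx
    have h : ρ x = ρ y :=
      le_antisymm (not_lt.1 fun h => hyx (Or.inl h)) (not_lt.1 fun h => hxy (Or.inl h))
    refine (hs (ρ y)).trichotomous x y (fun h' => hxy (Or.inr ⟨h, h'⟩)) fun h' => hyx ?_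
    exact Or.inr ⟨h.symm, h ▸ h'⟩

end LexicographicOrder

/-! ### Layered models -/

section LayeredModels

variable {B : Type u} [BooleanAlgebra B] {θ : Cardinal.{u}}

/-- `N` is an elementary submodel of size `κ` with `κ ⊆ N` and `S ⊆ N`, and `r` is a well-order such
that, over the part of `B` lying in `⋃ S`, each proper `r`-initial segment of `B ∩ N` generates a
relatively complete subalgebra of `B`. The relation `r` well-orders the whole universe; only its
restriction to `N` matters. -/
structure IsLayered (E : Expansion θ) (e : B ↪ ZFSet.{u}) (S : Finset ZFSet.{u})
    (κ : Cardinal.{u}) (N : ZFSet.{u}) (r : ZFSet.{u} → ZFSet.{u} → Prop) : Prop where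
  elementary : E.IsElementarySubmodel N
  card_eq : N.card = κ
  ord_subset : κ.ord.toZFSet ⊆ N
  mem : ∀ K ∈ S, K ∈ N
  isWellOrder : IsWellOrder ZFSet.{u} r
  reflects : ∀ y ∈ N, ReflectsConesTo
    (BooleanSubalgebra.closure {b : B | (∃ K ∈ S, e b ∈ K) ∨ e b ∈ N ∧ r (e b) y})

/-- A chain of submodels can be prolonged by a smaller submodel that contains its members. -/
theorem Expansion.IsSubmodelChain.insert [DecidableEq ZFSet.{u}] {E : Expansion θ}
    {S : Finset ZFSet.{u}} (hS : E.IsSubmodelChain S) {U : ZFSet.{u}}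
    (hU : E.IsElementarySubmodel U) (hcard : U.card.ord.toZFSet ⊆ U) (hmem : ∀ K ∈ S, K ∈ U)
    (hlt : ∀ K ∈ S, U.card < K.card) : E.IsSubmodelChain (Insert.insert U S) where
  elementary := by
    intro N hN
    rcases Finset.mem_insert.1 hN with rfl | hN
    exacts [hU, hS.elementary N hN]
  card_subset := by
    intro N hN
    rcases Finset.mem_insert.1 hN with rfl | hN
    exacts [hcard, hS.card_subset N hN]
  chain := by
    rw [Finset.coe_insert]
    exact hS.chain.insert fun K hK _ => Or.inr (hmem K hK)
  card_lt := by
    intro N₀ h₀ N₁ h₁ h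
    rcases Finset.mem_insert.1 h₀ with rfl | k₀ <;> rcases Finset.mem_insert.1 h₁ with rfl | k₁
    · exact absurd h (ZFSet.mem_irrefl _)
    · exact absurd h (ZFSet.mem_asymm (hmem _ k₁))
    · exact hlt _ k₀
    · exact hS.card_lt _ k₀ _ k₁ h

theorem Expansion.IsSubmodelChain.card_injOn {E : Expansion θ} {S : Finset ZFSet.{u}}
    (hS : E.IsSubmodelChain S) : Set.InjOn ZFSet.card (S : Set ZFSet.{u}) := by
  intro N hN K hK h
  by_contra hne
  rcases hS.chain hN hK hne with h' | h'
  · exact (hS.card_lt _ hN _ hK h').ne' h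
  · exact (hS.card_lt _ hK _ hN h').ne h

variable {E : Expansion θ} {e : B ↪ ZFSet.{u}}

/-- A countable submodel is layered by any enumeration in order type `ω`: its proper initial
segments are finite. -/
theorem exists_isLayered_aleph0 (hθ : ℵ₀ < θ) {S : Finset ZFSet.{u}}
    (hS : ∀ K ∈ S, K.Hereditarily fun y => y.card < θ)
    (hrefl : ReflectsConesTo (BooleanSubalgebra.closure {b : B | ∃ K ∈ S, e b ∈ K}))
    {X : Set ZFSet.{u}} (hX : #X ≤ ℵ₀) (hXθ : ∀ x ∈ X, x.Hereditarily fun y => y.card < θ) :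
    ∃ N r, X ⊆ {x | x ∈ N} ∧ IsLayered E e S ℵ₀ N r := by
  obtain ⟨N, hXN, hN, hcard, hord⟩ := E.exists_elementarySubmodel le_rfl hθ
    (X := X ∪ (S : Set ZFSet.{u})) (by
      rw [lift_aleph0, mk_le_aleph0_iff]
      exact ((Set.countable_coe_iff.1 (mk_le_aleph0_iff.1 hX)).union S.countable_toSet).to_subtype)
    (by rintro x (hx | hx); exacts [hXθ x hx, hS x hx])
  have hctbl : {x | x ∈ N}.Countable := by
    rw [← Set.countable_coe_iff, ← mk_le_aleph0_iff]
    have := ZFSet.cardinalMk_coe_sort (x := N)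
    rw [hcard, lift_aleph0] at this
    exact this.le
  obtain ⟨ρ, hρ⟩ := Set.countable_iff_exists_injOn.1 hctbl
  refine ⟨N, fun x y => ρ x < ρ y ∨ ρ x = ρ y ∧ WellOrderingRel x y,
    Set.subset_union_left.trans hXN, hN, hcard, hord, fun K hK => hXN (Or.inr hK),
    isWellOrder_lex ρ (fun _ => WellOrderingRel) fun _ => WellOrderingRel.isWellOrder, ?_⟩
  intro y _
  refine hrefl.closure_union_finite ?_
  have hfin : {x | x ∈ N ∧ ρ x ≤ ρ y}.Finite := by
    refine Set.Finite.of_finite_image (f := ρ) ((Set.finite_Iic (ρ y)).subset ?_)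
      (hρ.mono fun x hx => hx.1)
    rintro _ ⟨x, hx, rfl⟩
    exact hx.2
  refine (hfin.preimage e.injective.injOn).subset ?_
  rintro b ⟨hb, h | h⟩
  exacts [⟨hb, h.le⟩, ⟨hb, h.1.le⟩]

/-- The initial ordinal of `|β| + ω` is included in any set that includes both `ω` and `β`. -/
theorem card_sup_toZFSet_subset {β : Ordinal.{u}} {U : ZFSet.{u}}
    (h0 : (ℵ₀ : Cardinal.{u}).ord.toZFSet ⊆ U) (h : ∀ γ < β, γ.toZFSet ∈ U) :
    (max ℵ₀ β.card).ord.toZFSet ⊆ U := by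
  intro z hz
  obtain ⟨a, ha, rfl⟩ := Ordinal.mem_toZFSet_iff.1 hz
  rw [lt_ord, lt_max_iff] at ha
  rcases ha with ha | ha
  · exact h0 (Ordinal.mem_toZFSet_iff.2 ⟨a, lt_ord.2 ha, rfl⟩)
  · exact h a (lt_of_not_ge fun hle => ha.not_ge (Ordinal.card_le_card hle))

open Classical in
/-- The chain `S`, prolonged by the union `U` of the earlier models unless there are none. -/
noncomputable def prolong (S : Finset ZFSet.{u}) (β : Ordinal.{u}) (U : ZFSet.{u}) :
    Finset ZFSet.{u} :=
  if β = 0 then S else insert U S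

theorem mem_prolong {S : Finset ZFSet.{u}} {β : Ordinal.{u}} {U K : ZFSet.{u}} :
    K ∈ prolong S β U ↔ K ∈ S ∨ β ≠ 0 ∧ K = U := by
  classical
  unfold prolong
  split_ifs with h <;> simp [h, or_comm]

/-- The requirements on the `β`-th model of a filtration of a layered model: it is layered over the
union `U` of the earlier models, and contains `U`, `β` and the set `Y β`. -/
structure IsFiltrationStep (E : Expansion θ) (e : B ↪ ZFSet.{u}) (S : Finset ZFSet.{u})
    (Y : Ordinal.{u} → Set ZFSet.{u}) (β : Ordinal.{u}) (U N : ZFSet.{u})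
    (r : ZFSet.{u} → ZFSet.{u} → Prop) : Prop where
  layered : IsLayered E e (prolong S β U) (max ℵ₀ β.card) N r
  subset : U ⊆ N
  toZFSet_mem : β.toZFSet ∈ N
  param_subset : Y β ⊆ {x | x ∈ N}

/-- The union of the models before stage `β`. -/
noncomputable def unionBelow (M : Ordinal.{u} → ZFSet.{u}) (β : Ordinal.{u}) : ZFSet.{u} :=
  ZFSet.iUnion fun γ : Set.Iio β => M γ

theorem mem_unionBelow {M : Ordinal.{u} → ZFSet.{u}} {β : Ordinal.{u}} {x : ZFSet.{u}} :
    x ∈ unionBelow M β ↔ ∃ γ < β, x ∈ M γ := by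
  simp [unionBelow, ZFSet.mem_iUnion]

variable {S : Finset ZFSet.{u}} {Y : Ordinal.{u} → Set ZFSet.{u}} {M : Ordinal.{u} → ZFSet.{u}}
  {r : Ordinal.{u} → ZFSet.{u} → ZFSet.{u} → Prop}

/-- The models of a filtration increase continuously, so that the union of its first `β` models is
an elementary submodel of size `|β| + ω`. -/
theorem unionBelow_properties {β : Ordinal.{u}} (hβ : β ≠ 0)
    (h : ∀ γ < β, IsFiltrationStep E e S Y γ (unionBelow M γ) (M γ) (r γ)) :
    E.IsElementarySubmodel (unionBelow M β) ∧ (unionBelow M β).card = max ℵ₀ β.card ∧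
      (max ℵ₀ β.card).ord.toZFSet ⊆ unionBelow M β ∧ ∀ K ∈ S, K ∈ unionBelow M β := by
  have hpos : 0 < β := pos_iff_ne_zero.2 hβ
  have hsub : ∀ γ < β, M γ ⊆ unionBelow M β := fun γ hγ x hx => mem_unionBelow.2 ⟨γ, hγ, hx⟩
  have hmono : ∀ γ δ : Ordinal.{u}, γ ≤ δ → δ < β → M γ ⊆ M δ := by
    intro γ δ hγδ hδ
    rcases hγδ.eq_or_lt with rfl | hlt
    · exact fun _ hx => hx
    · exact fun x hx => (h δ hδ).subset (mem_unionBelow.2 ⟨γ, hlt, hx⟩)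
  have hord : (max ℵ₀ β.card).ord.toZFSet ⊆ unionBelow M β := by
    refine card_sup_toZFSet_subset ?_ fun γ hγ => hsub γ hγ (h γ hγ).toZFSet_mem
    have := (h 0 hpos).layered.ord_subset
    rw [Ordinal.card_zero, max_eq_left zero_le] at this
    exact fun x hx => hsub 0 hpos (this hx)
  refine ⟨?_, le_antisymm ?_ ?_, hord, ?_⟩
  · have : Nonempty (Set.Iio β) := ⟨⟨0, hpos⟩⟩
    refine Expansion.IsElementarySubmodel.iUnion ?_ fun γ => (h γ γ.2).layered.elementary
    exact directed_of_isDirected_le fun γ δ hγδ => hmono γ δ hγδ δ.2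
  · rw [← lift_le.{u + 1}]
    refine ZFSet.lift_card_iUnion_le_sum_card.trans ?_
    refine (sum_le_sum _ (fun _ => max ℵ₀ β.card) fun γ => ?_).trans ?_
    · rw [(h γ γ.2).layered.card_eq]
      exact max_le_max le_rfl (Ordinal.card_le_card (le_of_lt γ.2))
    · rw [sum_const, mk_Iio_ordinal, lift_lift, ← lift_umax.{u, u + 1}]
      simp only [← lift_mul, lift_le]
      exact mul_le_of_le (le_max_left _ _) (le_max_right _ _) le_rfl
  · have := ZFSet.card_mono hord
    rwa [Ordinal.card_toZFSet, card_ord] at this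
  · exact fun K hK => hsub 0 hpos ((h 0 hpos).layered.mem K (mem_prolong.2 (Or.inl hK)))

/-- The union of a filtration of length `κ` is layered: elements are compared by the stage at which
they enter, and those entering at the same stage `β` by the order `r β`. An initial segment then
consists of a union of earlier models together with an initial segment of the next model. -/
theorem isLayered_unionBelow {κ : Cardinal.{u}} (hκ : ℵ₀ ≤ κ)
    (h : ∀ γ < κ.ord, IsFiltrationStep E e S Y γ (unionBelow M γ) (M γ) (r γ))
    (hr : ∀ γ, IsWellOrder ZFSet.{u} (r γ)) :
    ∃ r', IsLayered E e S κ (unionBelow M κ.ord) r' := by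
  have h0 : κ.ord ≠ 0 := by
    rw [Ne, ord_eq_zero]
    exact (aleph0_pos.trans_le hκ).ne'
  obtain ⟨h1, h2, h3, h4⟩ := unionBelow_properties h0 h
  rw [card_ord, max_eq_right hκ] at h2 h3
  -- `ρ x` is the stage at which `x` enters; outside the union it is the junk value `0`.
  let ρ : ZFSet.{u} → Ordinal.{u} := fun x => sInf {γ | x ∈ M γ}
  refine ⟨_, h1, h2, h3, h4, isWellOrder_lex ρ r hr, ?_⟩
  intro y hy
  obtain ⟨γ, hγ, hyγ⟩ := mem_unionBelow.1 hy
  have hle : ∀ {x γ}, x ∈ M γ → ρ x ≤ γ := fun hx => csInf_le' hx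
  have hmem : ∀ {x γ}, x ∈ M γ → x ∈ M (ρ x) := fun {x γ} hx =>
    csInf_mem (s := {γ | x ∈ M γ}) ⟨γ, hx⟩
  have hyκ : ρ y < κ.ord := (hle hyγ).trans_lt hγ
  convert (h (ρ y) hyκ).layered.reflects y (hmem hyγ) using 2
  ext b
  simp only [Set.mem_ofPred_eq, mem_prolong]
  constructor
  · rintro (⟨K, hK, hb⟩ | ⟨hb, hlt | ⟨heq, hrb⟩⟩)
    · exact Or.inl ⟨K, Or.inl hK, hb⟩
    · obtain ⟨δ, -, hδ⟩ := mem_unionBelow.1 hb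
      exact Or.inl ⟨_, Or.inr ⟨hlt.ne_bot, rfl⟩, mem_unionBelow.2 ⟨_, hlt, hmem hδ⟩⟩
    · obtain ⟨δ, -, hδ⟩ := mem_unionBelow.1 hb
      exact Or.inr ⟨heq ▸ hmem hδ, hrb⟩
  · rintro (⟨K, hK | ⟨-, rfl⟩, hb⟩ | ⟨hb, hrb⟩)
    · exact Or.inl ⟨K, hK, hb⟩
    · obtain ⟨δ, hδ, hb⟩ := mem_unionBelow.1 hb
      exact Or.inr ⟨mem_unionBelow.2 ⟨δ, hδ.trans hyκ, hb⟩, Or.inl ((hle hb).trans_lt hδ)⟩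
    · refine Or.inr ⟨mem_unionBelow.2 ⟨_, hyκ, hb⟩, ?_⟩
      exact (hle hb).lt_or_eq.imp_right fun heq => ⟨heq, hrb⟩

/-- Layered models exist in all sizes up to `|B| + ω`, provided that `B` reflects cones to the
subalgebras given by chains of infinite submodels smaller than `B`. -/
theorem exists_isLayered (hBθ : max ℵ₀ #B < θ)
    (hrefl : ∀ S : Finset ZFSet.{u}, E.IsSubmodelChain S →
      (∀ K ∈ S, ℵ₀ ≤ K.card ∧ K.card < #B) →
      ReflectsConesTo (BooleanSubalgebra.closure {b : B | ∃ K ∈ S, e b ∈ K}))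
    (κ : Cardinal.{u}) (hκ : ℵ₀ ≤ κ) (hκB : κ ≤ max ℵ₀ #B) (S : Finset ZFSet.{u})
    (hS : E.IsSubmodelChain S) (hcard : ∀ K ∈ S, κ ≤ K.card ∧ K.card < #B) (X : Set ZFSet.{u})
    (hX : #X ≤ lift.{u + 1} κ) (hXθ : ∀ x ∈ X, x.Hereditarily fun y => y.card < θ) :
    ∃ N r, X ⊆ {x | x ∈ N} ∧ IsLayered E e S κ N r := by
  classical
  induction κ using WellFoundedLT.induction generalizing S X with
  | ind κ ih =>
    have hSθ : ∀ K ∈ S, K.Hereditarily fun y => y.card < θ := fun K hK =>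
      hereditarily_of_forall_mem
        ((hcard K hK).2.trans ((le_max_right _ _).trans_lt hBθ))
        fun x hx => (hS.elementary K hK).hereditarily hx
    rcases hκ.eq_or_lt with rfl | hlt
    · exact exists_isLayered_aleph0 ((le_max_left _ _).trans_lt hBθ) hSθ (hrefl S hS hcard)
        (by simpa using hX) hXθ
    -- Enumerate `X` along `κ`, so that each stage takes in one element of it.
    have hcardIio : #(Set.Iio κ.ord) = lift.{u + 1} κ := by rw [mk_Iio_ordinal, card_ord]
    obtain ⟨i⟩ : Nonempty (X ↪ Set.Iio κ.ord) := by rwa [← Cardinal.le_def, hcardIio]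
    set Y : Ordinal.{u} → Set ZFSet.{u} := fun β => {x | ∃ hx : x ∈ X, (i ⟨x, hx⟩).1 = β}
    -- A step function defined for all `β` and `U`, so that the models can be given by recursion
    -- before the steps are known to be possible.
    have hpick : ∀ (β : Ordinal.{u}) (U : ZFSet.{u}),
        ∃ p : ZFSet.{u} × (ZFSet.{u} → ZFSet.{u} → Prop), IsWellOrder ZFSet.{u} p.2 ∧
          ((∃ N r, IsFiltrationStep E e S Y β U N r) → IsFiltrationStep E e S Y β U p.1 p.2) := by
      intro β U
      by_cases h : ∃ N r, IsFiltrationStep E e S Y β U N r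
      · obtain ⟨N, r, hNr⟩ := h
        exact ⟨(N, r), hNr.layered.isWellOrder, fun _ => hNr⟩
      · exact ⟨(∅, WellOrderingRel), WellOrderingRel.isWellOrder, fun h' => absurd h' h⟩
    choose pick hwo hstep using hpick
    obtain ⟨M, hM⟩ : ∃ M : Ordinal.{u} → ZFSet.{u}, ∀ β, M β = (pick β (unionBelow M β)).1 :=
      ⟨wellFounded_lt.fix fun β rec => (pick β (ZFSet.iUnion fun γ : Set.Iio β => rec γ γ.2)).1,
        fun β => WellFounded.fix_eq _ _ _⟩
    have hgood : ∀ β < κ.ord, IsFiltrationStep E e S Y β (unionBelow M β) (M β)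
        (pick β (unionBelow M β)).2 := by
      intro β
      induction β using WellFoundedLT.induction with
      | ind β ihβ =>
        intro hβ
        have ihβ' : ∀ γ < β, IsFiltrationStep E e S Y γ (unionBelow M γ) (M γ)
            (pick γ (unionBelow M γ)).2 := fun γ hγ => ihβ γ hγ (hγ.trans hβ)
        rw [hM]
        refine hstep _ _ ?_
        set μ : Cardinal.{u} := max ℵ₀ β.card with hμ
        have hμκ : μ < κ := max_lt hlt (lt_ord.1 hβ)
        have hchain : E.IsSubmodelChain (prolong S β (unionBelow M β)) ∧
            (∀ K ∈ prolong S β (unionBelow M β), μ ≤ K.card ∧ K.card < #B) ∧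
            #{x | x ∈ unionBelow M β} ≤ lift.{u + 1} μ ∧
            ∀ x ∈ unionBelow M β, x.Hereditarily fun y => y.card < θ := by
          by_cases h0 : β = 0
          · have hempty : unionBelow M β = ∅ := by
              ext x
              simp [mem_unionBelow, h0]
            rw [hempty]
            refine ⟨by rwa [prolong, if_pos h0], ?_, ?_, ?_⟩
            · intro K hK
              have hK : K ∈ S := by simpa [mem_prolong, h0] using hK
              exact ⟨hμκ.le.trans (hcard K hK).1, (hcard K hK).2⟩
            · simp
            · simp
          · obtain ⟨h1, h2, h3, h4⟩ := unionBelow_properties h0 ihβ'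
            rw [← hμ] at h2 h3
            have hμB : μ < #B := by
              rcases lt_max_iff.1 (hμκ.trans_le hκB) with h | h
              · exact absurd h (le_max_left _ _).not_gt
              · exact h
            refine ⟨?_, ?_, ?_, fun x hx => h1.hereditarily hx⟩
            · rw [prolong, if_neg h0]
              refine hS.insert h1 (h2.symm ▸ h3) h4 fun K hK => ?_
              rw [h2]
              exact hμκ.trans_le (hcard K hK).1
            · intro K hK
              rcases mem_prolong.1 hK with hK | ⟨-, rfl⟩
              · exact ⟨hμκ.le.trans (hcard K hK).1, (hcard K hK).2⟩
              · exact ⟨h2.ge, h2.trans_lt hμB⟩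
            · rw [← h2]
              exact ZFSet.cardinalMk_coe_sort.le
        obtain ⟨hc1, hc2, hc3, hc4⟩ := hchain
        obtain ⟨N, r, hXN, hN⟩ := ih μ hμκ (le_max_left _ _) (hμκ.le.trans hκB) _ hc1 hc2
          ({x | x ∈ unionBelow M β} ∪ ({β.toZFSet} ∪ Y β)) (by
            have hμ' : ℵ₀ ≤ lift.{u + 1} μ := aleph0_le_lift.2 (le_max_left _ _)
            have hYβ : (Y β).Subsingleton := by
              rintro x ⟨hx, hxβ⟩ y ⟨hy, hyβ⟩
              simpa using i.injective (Subtype.ext (hxβ.trans hyβ.symm))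
            have hfin : #↑({β.toZFSet} ∪ Y β : Set ZFSet.{u}) ≤ lift.{u + 1} μ :=
              (lt_aleph0_iff_set_finite.2
                ((Set.finite_singleton _).union hYβ.finite)).le.trans hμ'
            exact (mk_union_le _ _).trans (add_le_of_le hμ' hc3 hfin))
          (by
            rintro x (hx | rfl | ⟨hx, -⟩)
            · exact hc4 x hx
            · refine hereditarily_toZFSet β (hβ.trans (ord_lt_ord.2 (hκB.trans_lt hBθ)))
            · exact hXθ x hx)
        exact ⟨N, r, hN, fun x hx => hXN (Or.inl hx), hXN (Or.inr (Or.inl rfl)),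
          fun x hx => hXN (Or.inr (Or.inr hx))⟩
    obtain ⟨r, hr⟩ := isLayered_unionBelow hκ hgood fun γ => hwo _ _
    refine ⟨_, r, fun x hx => ?_, hr⟩
    exact mem_unionBelow.2 ⟨i ⟨x, hx⟩, (i ⟨x, hx⟩).2,
      (hgood _ (i ⟨x, hx⟩).2).param_subset ⟨hx, rfl⟩⟩

end LayeredModels

/-! ### The embedding theorem -/

/-- Reflection to chains of infinite submodels smaller than `B` is all that the embedding
needs. -/
theorem embedsInFree_of_reflects {B : Type u} [BooleanAlgebra B] [Nontrivial B] (e : B ↪ ZFSet.{u})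
    (θ₀ : Cardinal.{u})
    (h : ∀ θ : Cardinal.{u}, θ₀ ≤ θ → θ.IsRegular → ∃ E : Expansion θ,
      ∀ S : Finset ZFSet.{u}, E.IsSubmodelChain S → (∀ K ∈ S, ℵ₀ ≤ K.card ∧ K.card < #B) →
        ReflectsConesTo (BooleanSubalgebra.closure {b : B | ∃ K ∈ S, e b ∈ K})) :
    EmbedsInFreeBooleanAlgebra B := by
  -- Choose `θ` so large that `B`, realized through `e`, is a subset of `H_θ` of size less than `θ`.
  obtain ⟨c, hc⟩ := exists_hereditarily (ZFSet.range e)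
  set m : Cardinal.{u} := max (max θ₀ c) (max ℵ₀ #B)
  set θ : Cardinal.{u} := Order.succ m
  have hmθ : m < θ := Order.lt_succ m
  have hθ : θ.IsRegular := isRegular_succ ((le_max_left _ _).trans (le_max_right _ _))
  obtain ⟨E, hE⟩ := h θ (((le_max_left _ _).trans (le_max_left _ _)).trans hmθ.le) hθ
  obtain ⟨N, r, hXN, hN⟩ := exists_isLayered ((le_max_right _ _).trans_lt hmθ) hE (max ℵ₀ #B)
    (le_max_left _ _) le_rfl ∅ ⟨by simp, by simp, by simp, by simp⟩ (by simp) (Set.range e) (by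
      refine le_trans ?_ (lift_le.2 (le_max_right _ _))
      rw [← lift_id'.{u, u + 1} #(Set.range e)]
      exact mk_range_le_lift.trans (lift_umax.{u, u + 1} ▸ le_rfl)) (by
      rintro _ ⟨b, rfl⟩
      exact (hc θ (((le_max_right _ _).trans (le_max_left _ _)).trans hmθ.le)).mem (by simp))
  have hr := hN.isWellOrder
  have hrB : IsWellOrder B fun b b' => r (e b) (e b') :=
    { wf := InvImage.wf e hr.wf
      trichotomous := fun b b' h h' => e.injective (hr.trichotomous _ _ h h') }
  refine embedsInFree_of_isWellOrder (g := id) (fun b b' => r (e b) (e b')) ?_ fun y => ?_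
  · rw [eq_top_iff]
    exact fun b _ => BooleanSubalgebra.subset_closure ⟨b, rfl⟩
  · convert hN.reflects (e y) (hXN ⟨y, rfl⟩) using 2
    rw [Set.image_id]
    ext b
    constructor
    · exact fun hb => Or.inr ⟨hXN ⟨b, rfl⟩, hb⟩
    · rintro (⟨K, hK, -⟩ | ⟨-, hb⟩)
      · simp at hK
      · exact hb

/-- There are only `n` infinite cardinals below `ℵ_n`, and the members of a chain of submodels have
distinct cardinalities. -/
theorem Expansion.IsSubmodelChain.card_le_of_lt_aleph {θ : Cardinal.{u}} {E : Expansion θ}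
    {S : Finset ZFSet.{u}} (hS : E.IsSubmodelChain S) {n : ℕ}
    (h : ∀ K ∈ S, ℵ₀ ≤ K.card ∧ K.card < ℵ_ n) : S.card ≤ n := by
  have key : ∀ K ∈ S, ∃ k < n, K.card = ℵ_ (k : Ordinal.{u}) := by
    intro K hK
    obtain ⟨h1, h2⟩ := h K hK
    obtain ⟨o, ho⟩ := mem_range_aleph_iff.2 h1
    rw [← ho, aleph_lt_aleph] at h2
    obtain ⟨k, rfl⟩ := Ordinal.lt_omega0.1 (h2.trans (Ordinal.natCast_lt_omega0 n))
    exact ⟨k, by exact_mod_cast h2, ho.symm⟩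
  choose! k hkn hk using key
  rw [← Finset.card_range n]
  refine Finset.card_le_card_of_injOn k (fun K hK => Finset.mem_range.2 (hkn K hK)) ?_
  intro K hK K' hK' heq
  exact hS.card_injOn hK hK' (by rw [hk K hK, hk K' hK', heq])

end ReflectingCones

theorem mainTheorem8 (B : Type u) [BooleanAlgebra B] [Nontrivial B] :
    (ReflectingCones.OmegaReflectsCones B → ReflectingCones.EmbedsInFreeBooleanAlgebra B) ∧
    (∀ n : ℕ, #B ≤ ℵ_ n → ReflectingCones.NReflectsCones n B →
      ReflectingCones.EmbedsInFreeBooleanAlgebra B) := by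
  constructor
  · rintro ⟨e, θ₀, h⟩
    refine ReflectingCones.embedsInFree_of_reflects e θ₀ fun θ hθ hreg => ?_
    obtain ⟨E, hE⟩ := h θ hθ hreg
    exact ⟨E, fun S hS _ => hE S.card S le_rfl hS⟩
  · rintro n hB ⟨e, θ₀, h⟩
    refine ReflectingCones.embedsInFree_of_reflects e θ₀ fun θ hθ hreg => ?_
    obtain ⟨E, hE⟩ := h θ hθ hreg
    exact ⟨E, fun S hS hcard => hE S (hS.card_le_of_lt_aleph fun K hK =>
      ⟨(hcard K hK).1, (hcard K hK).2.trans_le hB⟩) hS⟩
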